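/- **Setting.** Let $\mathbb H$ be the quaternions with their Euclidean structure, made a complex vector space by right multiplication by $i$; let $I,J,K$ be left multiplication by $i,j,k$. Let $V$ be an affine space with underlying vector space $\mathbb H$ (identified with $\mathbb H$ by choosing an origin), $\Gamma\subset\mathbb H$ a lattice, $M=V/\Gamma$ the flat quotient $4$-torus with projection $p:V\to M$, and $\mathscr T$ a Euclidean triangulation of $M$, i.e. a finite simplicial decomposition each of whose cells is the bijective image under $p$ of a Euclidean simplex of $V$. Let $\mathscr F$ be the space of locally constant $\mathbb H$-valued $1$-forms on the complement of the $3$-skeleton, that is, families $F=(F(\sigma))_\sigma$ of $\mathbb R$-linear maps $\mathbb H\to\mathbb H$ indexed by the $4$-cells $\sigma$ of $\mathscr T$, with the Euclidean metric $$\mathcal G(F_1,F_2)=\sum_{\sigma} g\big(F_1(\sigma),F_2(\sigma)\big)\,\mathrm{vol}(\sigma),\qquad g(A,B)=\sum_{e\in\{1,i,j,k\}}\langle Ae,Be\rangle .$$ Let $\mathscr F^c\subset\mathscr F$ be the subspace of Whitney forms: for any two intersecting $4$-cells $\sigma,\tau$, the maps $F(\sigma)$ and $F(\tau)$ agree on vectors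 tangent to $\sigma\cap\tau$. A polyhedral function $M\to\mathbb H$ is a continuous function that is affine on each cell. Let $H^1(M,\mathbb H)$ be the quotient of $\mathscr F^c$ by the differentials of polyhedral functions $M\to\mathbb H$, and for $\alpha\in H^1(M,\mathbb H)$ let $$\mathscr F^c_\alpha=\{F\in\mathscr F^c:\ [F]\in\mathbb R\alpha\}.$$ The hyperkähler moment map $\boldsymbol\mu=(\mu_I,\mu_J,\mu_K)$ sends $F$ to the triple of locally constant functions $$\mu_\bullet(F)=-\tfrac12\, g(\mathscr R_\bullet F,F),\qquad \mathscr R_\bullet F(v)=-F(\bullet\, v)\,i,\qquad \bullet=I,J,K.$$ Let $\phi(F)=\tfrac12\|\boldsymbol\mu(F)\|^2=\tfrac12\sum_\bullet\sum_\sigma \mu_\bullet(F)(\sigma)^2\,\mathrm{vol}(\sigma)$. The modified moment map flow on $\mathscr F^c_\alpha$ is $$\frac{\partial F_t}{\partial t}=-\Pi_\alpha\nabla\phi(F_t),$$ where $\nabla$ is the gradient for $\mathcal G$ and $\Pi_\alpha:\mathscr F\to\mathscr F^c_\alpha$ is the $\mathcal G$-orthogonal projection. Put $Z=\mathscr F^c_\alpha\cap\boldsymbol\mu^{-1}(0)$.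 A point $F\in Z$ is called regular if $\boldsymbol\mu:\mathscr F^c_\alpha\to\mathfrak t^3$, with $\mathfrak t$ the space of locally constant real functions, has constant rank on a neighbourhood of $F$ in $\mathscr F^c_\alpha$. **Theorem.** Let $\alpha\in H^1(M,\mathbb H)$ and let $F\in Z$ be a regular point. Then the modified moment map flow is stable in a neighbourhood of $F$ and converges exponentially fast. Precisely: there are constants $C,\lambda>0$ such that for every neighbourhood $U$ of $F$ in $\mathscr F^c_\alpha$ there is a neighbourhood $W$ of $F$ with the following property. For every $F_0\in W$ there is a solution $(F_t)_{t\ge 0}$ of the flow with initial condition $F_0$, and every such solution stays in $U$ for all $t\geq 0$ and converges to some $F_\infty\in U\cap Z$, with $$\|F_t-F_\infty\|_{\mathcal G}\le C e^{-\lambda t}\,\mathrm{dist}_{\mathcal G}(F_0,Z)\qquad\text{for all } t\ge 0 .$$ -/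

import Mathlib

open scoped Topology InnerProductSpace

noncomputable section

namespace PolyTorus

/-- The quaternions, a four-dimensional Euclidean space with orthonormal basis `1, i, j, k`.
The affine space `V` is identified with its underlying vector space by the choice of an origin. -/
abbrev HH : Type := Quaternion ℝ

instance : MeasurableSpace HH := borel HH

instance : BorelSpace HH := ⟨rfl⟩

/-- The imaginary units `i`, `j`, `k`. -/
def unit : Fin 3 → HH := ![⟨0, 1, 0, 0⟩, ⟨0, 0, 1, 0⟩, ⟨0, 0, 0, 1⟩]

/-- The orthonormal basis `1, i, j, k`. -/
def stdBasis : Fin 4 → HH := ![1, unit 0, unit 1, unit 2]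

/-! ### Linear algebra of `ℝ`-linear maps `HH → HH` (the fibre of `T^*M ⊗ HH`) -/

/-- The Euclidean inner product `g` on `HH^* ⊗ HH` induced by the inner product of `HH`. -/
def fibreInner (A B : HH →ₗ[ℝ] HH) : ℝ := ∑ e : Fin 4, ⟪A (stdBasis e), B (stdBasis e)⟫_ℝ

/-- The complex multiplication by `i` on `HH`-valued linear maps: complex numbers act on `HH` by
quaternionic multiplication on the right. -/
def mulI (A : HH →ₗ[ℝ] HH) : HH →ₗ[ℝ] HH := LinearMap.mulRight ℝ (unit 0) ∘ₗ A

/-- The almost complex structures `I · A = -A ∘ I` (for `a = 0`), and likewise `J` and `K`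
(for `a = 1, 2`), where `I, J, K` act on `HH` by left multiplication by `i, j, k`. -/
def cplx (a : Fin 3) (A : HH →ₗ[ℝ] HH) : HH →ₗ[ℝ] HH := -(A ∘ₗ LinearMap.mulLeft ℝ (unit a))

/-- The involutions `R_I, R_J, R_K`, given by `R A = i (I · A)`, and so on. -/
def involution (a : Fin 3) (A : HH →ₗ[ℝ] HH) : HH →ₗ[ℝ] HH := mulI (cplx a A)

/-- The fibrewise moment maps `-(1/2) g(R A, A)`. -/
def fibreMoment (a : Fin 3) (A : HH →ₗ[ℝ] HH) : ℝ :=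
  -(1 / 2) * fibreInner (involution a A) A

/-! ### Euclidean triangulations of the torus `M = HH / Γ` -/

/-- The quotient torus. -/
abbrev Torus (Γ : Submodule ℤ HH) : Type := HH ⧸ Γ.toAddSubgroup

/-- The canonical projection `p : HH → M`. -/
def proj (Γ : Submodule ℤ HH) (x : HH) : Torus Γ := QuotientAddGroup.mk x

/-- The image in the torus of the convex hull of a finite set of points. -/
def shadow (Γ : Submodule ℤ HH) (s : Finset HH) : Set (Torus Γ) :=
  proj Γ '' convexHull ℝ (s : Set HH)

/-- `σ` is a Euclidean simplex of the torus, and `s` is the vertex set of a Euclidean simplex of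
`HH` which the projection maps bijectively onto `σ`. -/
structure IsLift (Γ : Submodule ℤ HH) (s : Finset HH) (σ : Set (Torus Γ)) : Prop where
  nonempty : s.Nonempty
  affineIndependent : AffineIndependent ℝ ((↑) : s → HH)
  injOn : Set.InjOn (proj Γ) (convexHull ℝ (s : Set HH))
  image_eq : shadow Γ s = σ

/-- `ρ` is a face of the Euclidean simplex `σ`. -/
def IsFace (Γ : Submodule ℤ HH) (ρ σ : Set (Torus Γ)) : Prop :=
  ∃ s t : Finset HH, IsLift Γ s σ ∧ t ⊆ s ∧ t.Nonempty ∧ shadow Γ t = ρ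

/-- A Euclidean triangulation of the torus: a (finite) simplicial decomposition all of whose cells
are Euclidean simplices. -/
structure Triangulation (Γ : Submodule ℤ HH) where
  /-- The closed cells, of all dimensions. -/
  cells : Set (Set (Torus Γ))
  finite : cells.Finite
  isSimplex : ∀ σ ∈ cells, ∃ s, IsLift Γ s σ
  face_mem : ∀ σ ∈ cells, ∀ ρ, IsFace Γ ρ σ → ρ ∈ cells
  inter_isFace : ∀ σ ∈ cells, ∀ τ ∈ cells, (σ ∩ τ).Nonempty →
    IsFace Γ (σ ∩ τ) σ ∧ IsFace Γ (σ ∩ τ) τ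
  covers : ⋃₀ cells = Set.univ

namespace Triangulation

variable {Γ : Submodule ℤ HH} (T : Triangulation Γ)

/-- The four-dimensional cells: those with five vertices. -/
def FourCell : Type := {σ : Set (Torus Γ) // σ ∈ T.cells ∧ ∃ s, IsLift Γ s σ ∧ s.card = 5}

instance : Finite T.FourCell :=
  (T.finite.subset (fun _ h => h.1 :
    {σ | σ ∈ T.cells ∧ ∃ s, IsLift Γ s σ ∧ s.card = 5} ⊆ T.cells)).to_subtype

instance : Fintype T.FourCell := Fintype.ofFinite _

/-- The vertices of a simplex of `HH` over a given four-cell. It is unique up to translation by an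
element of `Γ`. -/
def vertices (σ : T.FourCell) : Finset HH := σ.2.2.choose

/-- The volume of a four-cell for the flat metric of the torus. -/
def vol (σ : T.FourCell) : ℝ :=
  (MeasureTheory.volume (convexHull ℝ (T.vertices σ : Set HH))).toReal

theorem vol_pos (σ : T.FourCell) : 0 < T.vol σ := by
  obtain ⟨hl, hc⟩ := σ.2.2.choose_spec
  have hcpt : IsCompact (convexHull ℝ (T.vertices σ : Set HH)) :=
    (T.vertices σ).finite_toSet.isCompact_convexHull ℝ
  refine ENNReal.toReal_pos ?_ hcpt.measure_lt_top.ne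
  have hspan : affineSpan ℝ (T.vertices σ : Set HH) = ⊤ := by
    have h := (hl.affineIndependent.affineSpan_eq_top_iff_card_eq_finrank_add_one).2
      (by rw [Fintype.card_coe, hc, Quaternion.finrank_eq_four])
    simpa [vertices] using h
  exact (MeasureTheory.Measure.measure_pos_of_nonempty_interior _
    (interior_convexHull_nonempty_iff_affineSpan_eq_top.2 hspan)).ne'

/-! ### The space of locally constant `HH`-valued one-forms -/

/-- The space `𝓕` of locally constant `HH`-valued `1`-forms on the complement of the `3`-skeleton:
a constant `ℝ`-linear map `HH → HH` for (the interior of) each four-cell. -/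
def Forms : Type := T.FourCell → (HH →ₗ[ℝ] HH)

instance : AddCommGroup T.Forms := inferInstanceAs (AddCommGroup (T.FourCell → (HH →ₗ[ℝ] HH)))

instance : Module ℝ T.Forms := inferInstanceAs (Module ℝ (T.FourCell → (HH →ₗ[ℝ] HH)))

instance : FiniteDimensional ℝ T.Forms :=
  inferInstanceAs (FiniteDimensional ℝ (T.FourCell → (HH →ₗ[ℝ] HH)))

/-- The metric `𝓖(F₁, F₂) = ∑ g(F₁(σ), F₂(σ)) vol(σ)`, the sum over all four-cells. -/
def metric (F₁ F₂ : T.Forms) : ℝ := ∑ σ : T.FourCell, fibreInner (F₁ σ) (F₂ σ) * T.vol σ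

theorem eq_zero_of_stdBasis (A : HH →ₗ[ℝ] HH) (h : ∀ e, A (stdBasis e) = 0) : A = 0 := by
  ext1 x
  have hx : x = x.re • stdBasis 0 + x.imI • stdBasis 1 + x.imJ • stdBasis 2
      + x.imK • stdBasis 3 := by
    apply Quaternion.ext <;>
      simp only [Quaternion.re_add, Quaternion.imI_add, Quaternion.imJ_add, Quaternion.imK_add,
        Quaternion.re_smul, Quaternion.imI_smul, Quaternion.imJ_smul, Quaternion.imK_smul] <;>
      simp [stdBasis, unit, Quaternion.re_one, Quaternion.imI_one, Quaternion.imJ_one,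
        Quaternion.imK_one]
  rw [hx]
  simp [h]

/-- The metric `𝓖` is positive definite, so that `𝓕` becomes a Euclidean space. -/
@[reducible] def core : InnerProductSpace.Core ℝ T.Forms where
  inner := T.metric
  conj_inner_symm F₁ F₂ := by
    simp [metric, fibreInner, real_inner_comm]
  re_inner_nonneg F := by
    refine Finset.sum_nonneg fun σ _ => mul_nonneg ?_ (T.vol_pos σ).le
    exact Finset.sum_nonneg fun e _ => real_inner_self_nonneg
  add_left F₁ F₂ F₃ := by
    change ∑ σ : T.FourCell, fibreInner (F₁ σ + F₂ σ) (F₃ σ) * T.vol σ = _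
    simp [metric, fibreInner, inner_add_left, Finset.sum_add_distrib, add_mul]
  smul_left F₁ F₂ r := by
    change ∑ σ : T.FourCell, fibreInner (r • F₁ σ) (F₂ σ) * T.vol σ = _
    simp [metric, fibreInner, real_inner_smul_left, Finset.mul_sum, mul_assoc, Finset.sum_mul]
  definite F h := by
    have hn : ∀ σ ∈ Finset.univ, 0 ≤ fibreInner (F σ) (F σ) * T.vol σ := fun σ _ =>
      mul_nonneg (Finset.sum_nonneg fun e _ => real_inner_self_nonneg) (T.vol_pos σ).le
    have h0 := (Finset.sum_eq_zero_iff_of_nonneg hn).1 h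
    funext σ
    refine eq_zero_of_stdBasis _ fun e => ?_
    have h1 : fibreInner (F σ) (F σ) = 0 :=
      (mul_eq_zero.1 (h0 σ (Finset.mem_univ _))).resolve_right (T.vol_pos σ).ne'
    have h2 := (Finset.sum_eq_zero_iff_of_nonneg
      (fun e _ => real_inner_self_nonneg)).1 h1 e (Finset.mem_univ _)
    exact inner_self_eq_zero.1 h2

instance : NormedAddCommGroup T.Forms := T.core.toNormedAddCommGroup

instance : InnerProductSpace ℝ T.Forms := InnerProductSpace.ofCore T.core.toCore

instance : CompleteSpace T.Forms := FiniteDimensional.complete ℝ T.Forms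

/-! ### Whitney forms and cohomology -/

/-- The space `𝓕^c` of Whitney forms: the pullbacks of `F(σ)` and `F(τ)` to the common face `σ ∩ τ`
of two four-cells `σ`, `τ` agree. -/
def whitney : Submodule ℝ T.Forms where
  carrier := {F | ∀ σ τ : T.FourCell, ∀ t : Finset HH, IsLift Γ t (σ.1 ∩ τ.1) →
    ∀ v ∈ vectorSpan ℝ (t : Set HH), F σ v = F τ v}
  zero_mem' := fun _ _ _ _ _ _ => rfl
  add_mem' := fun {F G} hF hG σ τ t ht v hv => by
    change F σ v + G σ v = F τ v + G τ v
    rw [hF σ τ t ht v hv, hG σ τ t ht v hv]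
  smul_mem' := fun r F hF σ τ t ht v hv => by
    change r • F σ v = r • F τ v
    rw [hF σ τ t ht v hv]

/-- An `HH`-valued polyhedral function on the torus: it is continuous and its lift to `HH` is affine
on every simplex of `HH` that lies over a cell. -/
structure IsPolyhedral (u : Torus Γ → HH) : Prop where
  continuous : Continuous u
  affine : ∀ σ ∈ T.cells, ∀ s, IsLift Γ s σ →
    ∃ f : HH →ᵃ[ℝ] HH, ∀ x ∈ convexHull ℝ (s : Set HH), u (proj Γ x) = f x

/-- `F` is the differential of `u`: on each four-cell `σ`, the form `F(σ)` is the linear part of the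
affine map that `u` defines on the simplices of `HH` over `σ`. -/
def IsDifferential (u : Torus Γ → HH) (F : T.Forms) : Prop :=
  ∀ σ : T.FourCell, ∀ s, IsLift Γ s σ.1 →
    ∃ f : HH →ᵃ[ℝ] HH, f.linear = F σ ∧ ∀ x ∈ convexHull ℝ (s : Set HH), u (proj Γ x) = f x

/-- The space of differentials of `HH`-valued polyhedral functions. -/
def exact : Submodule ℝ T.Forms where
  carrier := {F | ∃ u, T.IsPolyhedral u ∧ T.IsDifferential u F}
  zero_mem' := ⟨fun _ => 0, ⟨continuous_const, fun _ _ _ _ => ⟨0, fun _ _ => rfl⟩⟩,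
    fun _ _ _ => ⟨0, rfl, fun _ _ => rfl⟩⟩
  add_mem' := by
    rintro F G ⟨u, hu, hF⟩ ⟨w, hw, hG⟩
    refine ⟨fun x => u x + w x, ⟨hu.continuous.add hw.continuous, fun σ hσ s hs => ?_⟩,
      fun σ s hs => ?_⟩
    · obtain ⟨f, hf⟩ := hu.affine σ hσ s hs
      obtain ⟨k, hk⟩ := hw.affine σ hσ s hs
      exact ⟨f + k, fun x hx => by simp [hf x hx, hk x hx]⟩
    · obtain ⟨f, hf', hf⟩ := hF σ s hs
      obtain ⟨k, hk', hk⟩ := hG σ s hs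
      refine ⟨f + k, ?_, fun x hx => by simp [hf x hx, hk x hx]⟩
      change f.linear + k.linear = F σ + G σ
      rw [hf', hk']
  smul_mem' := by
    rintro r F ⟨u, hu, hF⟩
    refine ⟨fun x => r • u x, ⟨hu.continuous.const_smul r, fun σ hσ s hs => ?_⟩,
      fun σ s hs => ?_⟩
    · obtain ⟨f, hf⟩ := hu.affine σ hσ s hs
      exact ⟨r • f, fun x hx => by simp [hf x hx]⟩
    · obtain ⟨f, hf', hf⟩ := hF σ s hs
      refine ⟨r • f, ?_, fun x hx => by simp [hf x hx]⟩
      change r • f.linear = r • F σ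
      rw [hf']

/-- The cohomology group `H^1(M, HH)`: Whitney forms modulo differentials of polyhedral functions. -/
abbrev H1 : Type := T.whitney ⧸ T.exact.comap T.whitney.subtype

/-- The cohomology class of a Whitney form. -/
def cohomClass : T.whitney →ₗ[ℝ] T.H1 := (T.exact.comap T.whitney.subtype).mkQ

/-- The space `𝓕^c_α` of Whitney forms whose cohomology class is a real multiple of `α`. -/
def closedForms (α : T.H1) : Submodule ℝ T.Forms :=
  ((Submodule.span ℝ {α}).comap T.cohomClass).map T.whitney.subtype

/-! ### The hyperkähler moment map and the modified moment map flow -/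

/-- The hyperkähler moment map `(μ_I, μ_J, μ_K) : 𝓕 → 𝔱³`, where `𝔱` is the space of locally
constant real functions. -/
def moment (F : T.Forms) : Fin 3 → T.FourCell → ℝ := fun a σ => fibreMoment a (F σ)

/-- The functional `φ = ½ ‖μ‖²`, with `‖μ‖² = ∑ ∫_M μ_•²`. -/
def energy (F : T.Forms) : ℝ :=
  1 / 2 * ∑ a : Fin 3, ∑ σ : T.FourCell, T.moment F a σ ^ 2 * T.vol σ

/-- The restriction of the moment map to `𝓕^c_α`. -/
def momentOn (α : T.H1) (F : T.closedForms α) : Fin 3 → T.FourCell → ℝ := T.moment F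

/-- `𝓕^c_α ∩ μ⁻¹(0)`. -/
def zeroLocus (α : T.H1) : Set (T.closedForms α) := {F | T.momentOn α F = 0}

/-- A regular point: the moment map on `𝓕^c_α` has constant rank on a neighbourhood of the point. -/
def IsRegular (α : T.H1) (F : T.closedForms α) : Prop :=
  ∃ r : ℕ, ∀ᶠ G in 𝓝 F,
    Module.finrank ℝ (LinearMap.range (fderiv ℝ (T.momentOn α) G).toLinearMap) = r

/-- The right-hand side `-Π_α ∇φ(F)` of the modified moment map flow. Here `∇φ` is the gradient for
the metric `𝓖`, and `Π_α` is the `𝓖`-orthogonal projection of `𝓕` onto `𝓕^c_α`. -/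
def flowField (α : T.H1) (F : T.closedForms α) : T.closedForms α :=
  -(T.closedForms α).orthogonalProjectionOnto (gradient T.energy (F : T.Forms))

/-- A solution, for times `t ∈ [0, ∞)`, of the modified moment map flow `∂F/∂t = -Π_α ∇φ(F)`. -/
def IsFlowLine (α : T.H1) (γ : ℝ → T.closedForms α) : Prop :=
  ∀ t : ℝ, 0 ≤ t → HasDerivWithinAt γ (T.flowField α (γ t)) (Set.Ici 0) t

end Triangulation

end PolyTorus

end

/-! On the finite-dimensional space `T.closedForms α` the flow is the negative gradient flow of the
restricted energy φ, because projecting ∇φ orthogonally to a subspace gives the gradient of the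
restriction.

The crux is a Polyak–Łojasiewicz inequality c φ ≤ |∇φ|² near F. Since μ is quadratic, Euler's
identity dμ_G(G/2) = μ(G) puts μ(G) in the range of dμ_G. Constant rank keeps the nonzero singular
values of dμ_G away from 0 near F, so μ(G) = dμ_G(v) for some v with |v| ≤ k|μ(G)|. Then 2φ(G) =
⟨∇φ(G), v⟩ ≤ k|∇φ(G)||μ(G)|, and |μ|² ≤ Bφ gives the inequality
(`polyak_lojasiewicz_of_constant_rank`).

Along a flow line the inequality makes φ decay like exp(-ct) and bounds the length by (2/√c)√φ at
the starting point. A line starting near F is therefore trapped, exists for all time and converges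
at rate c/2 to a zero of φ, that is, to a point of Z. Finally √φ(F₀) is at most a constant times the
distance to Z, because μ is locally Lipschitz and vanishes on Z
(`gradient_flow_exponentially_stable`). No manifold structure on Z is needed. -/

noncomputable section

open Set Metric Filter
open scoped NNReal

/-! ### Global forward solutions of bounded Lipschitz fields -/

section GlobalExistence

variable {E : Type*} [NormedAddCommGroup E] [NormedSpace ℝ E] [CompleteSpace E]

/-- A bounded, globally Lipschitz vector field has forward integral curves for all times. -/
theorem exists_forward_solution_of_lipschitzWith {v : E → E} {K L : ℝ≥0} (hK : LipschitzWith K v)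
    (hL : ∀ x, ‖v x‖ ≤ L) (x₀ : E) :
    ∃ γ : ℝ → E, γ 0 = x₀ ∧ ∀ t, 0 ≤ t → HasDerivWithinAt γ (v (γ t)) (Ici 0) t := by
  have key : ∀ n : ℕ, ∃ γ : ℝ → E, γ 0 = x₀ ∧
      ∀ t ∈ Icc (0 : ℝ) n, HasDerivWithinAt γ (v (γ t)) (Icc (0 : ℝ) n) t := by
    intro n
    -- At speed at most `L` a curve stays in the ball of radius `L * n` up to time `n`, so the time
    -- interval need not be shrunk.
    have hpl : IsPicardLindelof (fun _ => v) (tmin := 0) (tmax := n)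
        ⟨0, le_rfl, Nat.cast_nonneg n⟩ x₀ (L * n) 0 L K := by
      refine IsPicardLindelof.of_time_independent (fun x _ => hL x) hK.lipschitzOnWith ?_
      simp
    exact hpl.exists_eq_forall_mem_Icc_hasDerivWithinAt₀
  choose γ h0 hγ using key
  have hagree : ∀ m n : ℕ, m ≤ n → EqOn (γ m) (γ n) (Icc (0 : ℝ) m) := by
    intro m n hmn
    have hmn' : (m : ℝ) ≤ n := Nat.cast_le.2 hmn
    have hsub : Icc (0 : ℝ) m ⊆ Icc (0 : ℝ) n := Icc_subset_Icc_right hmn'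
    have hright : ∀ k : ℕ, m ≤ k → ∀ t ∈ Ico (0 : ℝ) m,
        HasDerivWithinAt (γ k) (v (γ k t)) (Ici t) t := fun k hk t ht => by
      have hmk : (m : ℝ) ≤ k := Nat.cast_le.2 hk
      refine (hγ k t ⟨ht.1, ht.2.le.trans hmk⟩).mono_of_mem_nhdsWithin ?_
      exact mem_of_superset (Icc_mem_nhdsGE (ht.2.trans_le hmk))
        (Icc_subset_Icc_left ht.1)
    refine ODE_solution_unique (v := fun _ => v) (fun _ => hK)
      (fun t ht => (hγ m t ht).continuousWithinAt) (hright m le_rfl)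
      (fun t ht => ((hγ n t (hsub ht)).mono hsub).continuousWithinAt) (hright n hmn) ?_
    rw [h0, h0]
  -- The `+ 1` puts `t` strictly below the right end of its interval, so that a derivative within
  -- `Icc 0 N` is one within `Ici 0`.
  refine ⟨fun t => γ (⌈t⌉₊ + 1) t, h0 _, fun t ht => ?_⟩
  have hlt : t < ((⌈t⌉₊ + 1 : ℕ) : ℝ) := by
    push_cast
    exact (Nat.le_ceil t).trans_lt (lt_add_one _)
  set N := ⌈t⌉₊ + 1 with hN
  have hd : HasDerivWithinAt (γ N) (v (γ N t)) (Ici 0) t := by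
    refine (hγ N t ⟨ht, hlt.le⟩).mono_of_mem_nhdsWithin ?_
    rw [← Ici_inter_Iic]
    exact inter_mem_nhdsWithin _ (Iic_mem_nhds hlt)
  refine hd.congr_of_eventuallyEq ?_ rfl
  filter_upwards [inter_mem_nhdsWithin (Ici (0 : ℝ)) (Iio_mem_nhds hlt)] with s hs
  have hs0 : (0 : ℝ) ≤ s := hs.1
  have hsc : s ≤ ((⌈s⌉₊ + 1 : ℕ) : ℝ) := by
    push_cast
    exact (Nat.le_ceil s).trans (lt_add_one _).le
  rcases le_total (⌈s⌉₊ + 1) N with h | h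
  · exact hagree _ _ h ⟨hs0, hsc⟩
  · exact (hagree _ _ h ⟨hs0, (show s < N from hs.2).le⟩).symm

end GlobalExistence

/-! ### Gradient flows under a Polyak–Łojasiewicz inequality -/

section GradientFlow

variable {E : Type*} [NormedAddCommGroup E] [InnerProductSpace ℝ E] [CompleteSpace E]
variable {φ : E → ℝ} {g : E → E} {c : ℝ}

theorem HasGradientAt.hasDerivWithinAt_comp {x' y : E} {γ : ℝ → E} {s : Set ℝ} {t : ℝ}
    (h : HasGradientAt φ y (γ t)) (hγ : HasDerivWithinAt γ x' s t) :
    HasDerivWithinAt (fun u => φ (γ u)) ⟪y, x'⟫_ℝ s t := by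
  exact h.hasFDerivAt.comp_hasDerivWithinAt t hγ

/-- The energy decays exponentially along a gradient line on which a Polyak–Łojasiewicz inequality
holds. -/
theorem energy_le_exp_of_gradient_line (hg : ∀ x, HasGradientAt φ (g x) x) {γ : ℝ → E} {a b : ℝ}
    (hab : a ≤ b) (hγ : ∀ t ∈ Icc a b, HasDerivWithinAt γ (-g (γ t)) (Ici a) t)
    (hc : ∀ t ∈ Icc a b, c * φ (γ t) ≤ ‖g (γ t)‖ ^ 2) :
    φ (γ b) ≤ Real.exp (-(c * (b - a))) * φ (γ a) := by
  have hder : ∀ t ∈ Icc a b, HasDerivWithinAt (fun u => Real.exp (c * (u - a)) * φ (γ u))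
      (Real.exp (c * (t - a)) * c * φ (γ t) + Real.exp (c * (t - a)) * ⟪g (γ t), -g (γ t)⟫_ℝ)
      (Icc a b) t := fun t ht => by
    have h1 : HasDerivAt (fun u : ℝ => Real.exp (c * (u - a))) (Real.exp (c * (t - a)) * c) t := by
      simpa using (((hasDerivAt_id t).sub_const a).const_mul c).exp
    exact h1.hasDerivWithinAt.mul
      (((hg _).hasDerivWithinAt_comp (hγ t ht)).mono Icc_subset_Ici_self)
  have hanti := antitoneOn_of_hasDerivWithinAt_nonpos (convex_Icc a b)
    (fun t ht => (hder t ht).continuousWithinAt)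
    (fun t ht => (hder t (interior_subset ht)).mono interior_subset) (fun t ht => by
      have h1 := hc t (interior_subset ht)
      have h2 := Real.exp_pos (c * (t - a))
      rw [inner_neg_right, real_inner_self_eq_norm_sq]
      nlinarith)
  have h := hanti ⟨le_rfl, hab⟩ ⟨hab, le_rfl⟩ hab
  simp only [sub_self, mul_zero, Real.exp_zero, one_mul] at h
  rw [Real.exp_neg, ← div_eq_inv_mul, le_div_iff₀ (Real.exp_pos _), mul_comm]
  exact h

/-- By AM-GM, `2 * y` is at most `k * √(p + η) + y ^ 2 / (k * √(p + η))`, and `k * √(p + η) ≤ y + k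
* √η`. With `y = ‖g‖` and `p = φ` this bounds the speed of a gradient line by the rate of decrease
of `√(φ + η)`, up to a small error. -/
theorem le_add_mul_of_mul_sq_le {y p η k : ℝ} (hp : 0 ≤ p) (hη : 0 < η) (hk : 0 < k)
    (hy : 0 ≤ y) (h : k ^ 2 * p ≤ y ^ 2) :
    y ≤ k * √η + y ^ 2 / (k * √(p + η)) := by
  have hb : 0 < √(p + η) := Real.sqrt_pos.2 (by linarith)
  have hkb : 0 < k * √(p + η) := mul_pos hk hb
  have h1 : √(p + η) ≤ √p + √η := by
    refine Real.sqrt_le_iff.2 ⟨by positivity, ?_⟩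
    nlinarith [Real.sq_sqrt hp, Real.sq_sqrt hη.le, Real.sqrt_nonneg p, Real.sqrt_nonneg η,
      mul_nonneg (Real.sqrt_nonneg p) (Real.sqrt_nonneg η)]
  have h2 : k * √p ≤ y := by
    refine abs_le_of_sq_le_sq' ?_ hy |>.2
    rw [mul_pow, Real.sq_sqrt hp]
    exact h
  have h3 : 2 * y ≤ k * √(p + η) + y ^ 2 / (k * √(p + η)) := by
    have h4 : k * √(p + η) + y ^ 2 / (k * √(p + η)) - 2 * y
        = (k * √(p + η) - y) ^ 2 / (k * √(p + η)) := by
      field_simp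
      ring
    have h5 : 0 ≤ (k * √(p + η) - y) ^ 2 / (k * √(p + η)) := by positivity
    linarith
  nlinarith

/-- The length of a gradient line is controlled by the drop of the square root of the energy. -/
theorem norm_sub_le_of_gradient_line (hg : ∀ x, HasGradientAt φ (g x) x) (hφ : ∀ x, 0 ≤ φ x)
    (hc0 : 0 < c) {γ : ℝ → E} {a b : ℝ} (hab : a ≤ b)
    (hγ : ∀ t ∈ Icc a b, HasDerivWithinAt γ (-g (γ t)) (Ici a) t)
    (hc : ∀ t ∈ Icc a b, c * φ (γ t) ≤ ‖g (γ t)‖ ^ 2) :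
    ‖γ b - γ a‖ ≤ 2 / √c * (√(φ (γ a)) - √(φ (γ b))) := by
  have hk : 0 < √c := Real.sqrt_pos.2 hc0
  -- The square root is not differentiable at 0, so φ is shifted by `η`, which tends to 0 at the
  -- end.
  have hηbound : ∀ η : ℝ, 0 < η →
      ‖γ b - γ a‖ ≤ √c * √η * (b - a) + 2 / √c * (√(φ (γ a) + η) - √(φ (γ b) + η)) := by
    intro η hη
    have hB : ∀ t ∈ Icc a b, HasDerivWithinAt
        (fun u => √c * √η * (u - a) + 2 / √c * (√(φ (γ a) + η) - √(φ (γ u) + η)))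
        (√c * √η + 2 / √c * (-(⟪g (γ t), -g (γ t)⟫_ℝ / (2 * √(φ (γ t) + η))))) (Ici a) t := by
      intro t ht
      have h1 : HasDerivWithinAt (fun u => √(φ (γ u) + η))
          (⟪g (γ t), -g (γ t)⟫_ℝ / (2 * √(φ (γ t) + η))) (Ici a) t :=
        (((hg _).hasDerivWithinAt_comp (hγ t ht)).add_const η).sqrt
          (by have := hφ (γ t); positivity)
      have h2 : HasDerivWithinAt (fun u => √c * √η * (u - a)) (√c * √η) (Ici a) t := by
        simpa using (((hasDerivAt_id t).sub_const a).const_mul (√c * √η)).hasDerivWithinAt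
      exact h2.add ((h1.const_sub _).const_mul _)
    refine image_norm_le_of_norm_deriv_right_le_deriv_boundary'
      (f := fun u => γ u - γ a) (f' := fun u => -g (γ u)) (a := a) (b := b)
      (fun t ht => (((hγ t ht).sub_const _).mono Icc_subset_Ici_self).continuousWithinAt)
      (fun t ht => ((hγ t (Ico_subset_Icc_self ht)).sub_const _).mono (Ici_subset_Ici.2 ht.1))
      (by simp) (fun t ht => ((hB t ht).mono Icc_subset_Ici_self).continuousWithinAt)
      (fun t ht => (hB t (Ico_subset_Icc_self ht)).mono (Ici_subset_Ici.2 ht.1))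
      (fun t ht => ?_) ⟨hab, le_rfl⟩
    have h3 := le_add_mul_of_mul_sq_le (hφ (γ t)) hη hk (norm_nonneg (g (γ t)))
      (by rw [Real.sq_sqrt hc0.le]; exact hc t (Ico_subset_Icc_self ht))
    rw [norm_neg, inner_neg_right, real_inner_self_eq_norm_sq]
    refine h3.trans (le_of_eq ?_)
    have : √(φ (γ t) + η) ≠ 0 := (Real.sqrt_pos.2 (by have := hφ (γ t); linarith)).ne'
    field_simp
  have hlim : Tendsto
      (fun η : ℝ => √c * √η * (b - a) + 2 / √c * (√(φ (γ a) + η) - √(φ (γ b) + η)))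
      (𝓝[>] 0) (𝓝 (2 / √c * (√(φ (γ a)) - √(φ (γ b))))) := by
    have hcont : Continuous
        (fun η : ℝ => √c * √η * (b - a) + 2 / √c * (√(φ (γ a) + η) - √(φ (γ b) + η))) := by
      fun_prop
    have := hcont.tendsto 0
    simp only [Real.sqrt_zero, mul_zero, zero_mul, add_zero, zero_add] at this
    exact this.mono_left nhdsWithin_le_nhds
  exact ge_of_tendsto hlim (eventually_nhdsWithin_of_forall hηbound)

/-- A gradient line of low energy that starts near the center of a ball on which a
Polyak–Łojasiewicz inequality holds cannot leave the ball. The vector field need only be the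
gradient on the ball. -/
theorem mem_ball_of_gradient_line (hg : ∀ x, HasGradientAt φ (g x) x) (hφ : ∀ x, 0 ≤ φ x)
    (hc0 : 0 < c) {F : E} {ε : ℝ} {v : E → E}
    (hv : ∀ x ∈ closedBall F ε, v x = -g x)
    (hc : ∀ x ∈ closedBall F ε, c * φ x ≤ ‖g x‖ ^ 2) {γ : ℝ → E}
    (hγ : ∀ t, 0 ≤ t → HasDerivWithinAt γ (v (γ t)) (Ici 0) t)
    (h0 : ‖γ 0 - F‖ + 2 / √c * √(φ (γ 0)) < ε) {t : ℝ} (ht : 0 ≤ t) : γ t ∈ ball F ε := by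
  by_contra hout
  have hcont : ContinuousOn γ (Ici 0) := fun s hs => (hγ s hs).continuousWithinAt
  -- The least element `τ` of `S` is the first exit time. The length bound on `[0, τ]` then
  -- contradicts `ε ≤ ‖γ τ - F‖`.
  set S : Set ℝ := Icc 0 t ∩ {s | ε ≤ ‖γ s - F‖} with hS
  have hScl : IsClosed S :=
    ((hcont.mono Icc_subset_Ici_self).sub continuousOn_const).norm.preimage_isClosed_of_isClosed
      isClosed_Icc isClosed_Ici
  have hScpt : IsCompact S := isCompact_Icc.of_isClosed_subset hScl inter_subset_left
  have hSne : S.Nonempty := ⟨t, ⟨ht, le_rfl⟩, by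
    simpa [mem_ball, dist_eq_norm, not_lt] using hout⟩
  obtain ⟨τ, hτ, hmin⟩ := hScpt.exists_isLeast hSne
  have hτ0 : 0 ≤ τ := hτ.1.1
  have hbefore : ∀ s ∈ Ico 0 τ, γ s ∈ closedBall F ε := fun s hs => by
    rw [mem_closedBall, dist_eq_norm]
    by_contra hlt
    exact absurd (hmin ⟨⟨hs.1, hs.2.le.trans hτ.1.2⟩, (not_le.1 hlt).le⟩) (not_le.2 hs.2)
  have hK : 0 ≤ 2 / √c * √(φ (γ 0)) := by positivity
  have hτpos : 0 < τ := by
    refine hτ0.lt_of_ne fun h => ?_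
    have h2 : ε ≤ ‖γ τ - F‖ := hτ.2
    rw [← h] at h2
    linarith
  -- By continuity `γ τ` still lies in the closed ball, so the inequality holds up to and including
  -- the exit time.
  have hall : ∀ s ∈ Icc 0 τ, γ s ∈ closedBall F ε := by
    have hcl : IsClosed (Icc 0 τ ∩ γ ⁻¹' closedBall F ε) :=
      (hcont.mono Icc_subset_Ici_self).preimage_isClosed_of_isClosed isClosed_Icc isClosed_closedBall
    have : closure (Ico 0 τ) ⊆ Icc 0 τ ∩ γ ⁻¹' closedBall F ε :=
      closure_minimal (fun s hs => ⟨Ico_subset_Icc_self hs, hbefore s hs⟩) hcl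
    rw [closure_Ico hτpos.ne] at this
    exact fun s hs => (this hs).2
  have hlen := norm_sub_le_of_gradient_line hg hφ hc0 hτ0 (γ := γ)
    (fun s hs => by rw [← hv _ (hall s hs)]; exact hγ s hs.1) (fun s hs => hc _ (hall s hs))
  have h1 : ‖γ τ - F‖ ≤ ‖γ τ - γ 0‖ + ‖γ 0 - F‖ := norm_sub_le_norm_sub_add_norm_sub _ _ _
  have h2 : 2 / √c * (√(φ (γ 0)) - √(φ (γ τ))) ≤ 2 / √c * √(φ (γ 0)) := by
    have := Real.sqrt_nonneg (φ (γ τ))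
    gcongr
    linarith
  have h3 : ε ≤ ‖γ τ - F‖ := hτ.2
  linarith

/-- A trapped gradient line converges exponentially fast to a zero of the energy. -/
theorem exists_limit_of_gradient_line (hg : ∀ x, HasGradientAt φ (g x) x) (hφ : ∀ x, 0 ≤ φ x)
    (hc0 : 0 < c) {γ : ℝ → E} (hγ : ∀ t, 0 ≤ t → HasDerivWithinAt γ (-g (γ t)) (Ici 0) t)
    (hc : ∀ t, 0 ≤ t → c * φ (γ t) ≤ ‖g (γ t)‖ ^ 2) :
    ∃ x, φ x = 0 ∧ Tendsto γ atTop (𝓝 x) ∧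
      ∀ t, 0 ≤ t → ‖γ t - x‖ ≤ 2 / √c * (Real.exp (-(c / 2 * t)) * √(φ (γ 0))) := by
  have henergy : ∀ t, 0 ≤ t → √(φ (γ t)) ≤ Real.exp (-(c / 2 * t)) * √(φ (γ 0)) := by
    intro t ht
    have h := energy_le_exp_of_gradient_line hg ht (γ := γ) (c := c)
      (fun s hs => hγ s hs.1) (fun s hs => hc s hs.1)
    refine Real.sqrt_le_iff.2 ⟨by positivity, ?_⟩
    rw [mul_pow, Real.sq_sqrt (hφ _), ← Real.exp_nat_mul]
    refine h.trans (le_of_eq ?_)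
    congr 2
    push_cast
    ring
  have hdist : ∀ s t, 0 ≤ s → s ≤ t →
      ‖γ t - γ s‖ ≤ 2 / √c * (Real.exp (-(c / 2 * s)) * √(φ (γ 0))) := by
    intro s t hs hst
    have h := norm_sub_le_of_gradient_line hg hφ hc0 hst (γ := γ)
      (fun u hu => (hγ u (hs.trans hu.1)).mono (Ici_subset_Ici.2 hs))
      (fun u hu => hc u (hs.trans hu.1))
    refine h.trans ?_
    have h1 := Real.sqrt_nonneg (φ (γ t))
    have h2 := henergy s hs
    gcongr
    linarith
  have hexp : Tendsto (fun t : ℝ => Real.exp (-(c / 2 * t))) atTop (𝓝 0) :=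
    Real.tendsto_exp_neg_atTop_nhds_zero.comp
      (tendsto_id.const_mul_atTop (by positivity : (0 : ℝ) < c / 2))
  have hzero : Tendsto (fun t : ℝ => 2 / √c * (Real.exp (-(c / 2 * t)) * √(φ (γ 0))))
      atTop (𝓝 0) := by
    simpa using (hexp.mul_const (√(φ (γ 0)))).const_mul (2 / √c)
  have hcauchy : CauchySeq γ := by
    refine Metric.cauchySeq_iff'.2 fun ε hε => ?_
    obtain ⟨N, hN, hN0⟩ := ((hzero.eventually (gt_mem_nhds hε)).and
      (eventually_ge_atTop (0 : ℝ))).exists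
    exact ⟨N, fun n hn => by rw [dist_eq_norm]; exact (hdist N n hN0 hn).trans_lt hN⟩
  obtain ⟨x, hx⟩ := cauchySeq_tendsto_of_complete hcauchy
  refine ⟨x, ?_, hx, fun t ht => ?_⟩
  · have h1 : Tendsto (fun t => √(φ (γ t))) atTop (𝓝 (√(φ x))) :=
      ((Real.continuous_sqrt.continuousAt).comp (hg x).continuousAt).tendsto.comp hx
    have h2 : Tendsto (fun t => √(φ (γ t))) atTop (𝓝 0) := by
      refine squeeze_zero' (Eventually.of_forall fun t => Real.sqrt_nonneg _)
        ((eventually_ge_atTop (0 : ℝ)).mono henergy) ?_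
      simpa using hexp.mul_const (√(φ (γ 0)))
    exact (Real.sqrt_eq_zero (hφ x)).1 (tendsto_nhds_unique h1 h2)
  · have h1 : Tendsto (fun s => ‖γ s - γ t‖) atTop (𝓝 ‖x - γ t‖) :=
      (hx.sub_const (γ t)).norm
    rw [norm_sub_rev]
    exact le_of_tendsto h1 ((eventually_ge_atTop t).mono fun s hs => hdist t s ht hs)

/-- Near a zero of a nonnegative function that satisfies a Polyak–Łojasiewicz inequality and whose
square root is controlled by the distance to its zeros, the negative gradient flow is stable and
converges exponentially fast. -/
theorem gradient_flow_exponentially_stable [FiniteDimensional ℝ E]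
    (hg : ∀ x, HasGradientAt φ (g x) x) (hgs : ContDiff ℝ 1 g) (hφ : ∀ x, 0 ≤ φ x)
    (hc0 : 0 < c) {F : E} (hF : φ F = 0) (hc : ∀ᶠ x in 𝓝 F, c * φ x ≤ ‖g x‖ ^ 2)
    {L : ℝ} (hL0 : 0 < L)
    (hL : ∀ᶠ p in 𝓝 F ×ˢ 𝓝 F, φ p.2 = 0 → √(φ p.1) ≤ L * ‖p.1 - p.2‖) :
    ∃ C : ℝ, 0 < C ∧ ∃ lam : ℝ, 0 < lam ∧ ∀ U ∈ 𝓝 F, ∃ W ∈ 𝓝 F, ∀ F₀ ∈ W,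
      (∃ γ : ℝ → E, (∀ t, 0 ≤ t → HasDerivWithinAt γ (-g (γ t)) (Ici 0) t) ∧ γ 0 = F₀) ∧
      ∀ γ : ℝ → E, (∀ t, 0 ≤ t → HasDerivWithinAt γ (-g (γ t)) (Ici 0) t) → γ 0 = F₀ →
        (∀ t : ℝ, 0 ≤ t → γ t ∈ U) ∧
        ∃ x ∈ U, φ x = 0 ∧ ∀ t : ℝ, 0 ≤ t → ‖γ t - x‖ ≤
            C * Real.exp (-(lam * t)) * infDist F₀ {x | φ x = 0} := by
  have hcpos : 0 < √c := Real.sqrt_pos.2 hc0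
  -- Both constants depend on `c` and `L` only, hence not on `U`.
  refine ⟨2 / √c * L, by positivity, c / 2, by positivity, fun U hU => ?_⟩
  obtain ⟨V, hV, hVL⟩ := eventually_prod_self_iff'.1 hL
  obtain ⟨r, hr, hrV⟩ := nhds_basis_closedBall.mem_iff.1 hV
  obtain ⟨ε, hε, hεsub⟩ := nhds_basis_closedBall.mem_iff.1 (inter_mem hU hc)
  have hφc : Continuous φ := continuous_iff_continuousAt.2 fun x => (hg x).continuousAt
  have hW : ∀ᶠ x in 𝓝 F, ‖x - F‖ + 2 / √c * √(φ x) < ε ∧ ‖x - F‖ < r / 2 := by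
    have h1 : Continuous fun x => ‖x - F‖ + 2 / √c * √(φ x) := by fun_prop
    have h2 : Continuous fun x => ‖x - F‖ := by fun_prop
    refine (h1.continuousAt.eventually_lt_const ?_).and (h2.continuousAt.eventually_lt_const ?_)
    · simpa [hF] using hε
    · simpa using half_pos hr
  refine ⟨_, hW, fun F₀ hF₀ => ⟨?_, fun γ hγ h0 => ?_⟩⟩
  -- The cut-off field has compact support, hence is bounded and Lipschitz and has a global
  -- solution. Trapping keeps this solution where `χ = 1`, so it solves the original equation.
  · let χ : ContDiffBump F := ⟨ε, ε + 1, hε, lt_add_one ε⟩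
    set v : E → E := fun x => χ x • (-g x) with hv
    have hvs : ContDiff ℝ 1 v := χ.contDiff.smul hgs.neg
    have hvc : HasCompactSupport v := χ.hasCompactSupport.smul_right
    obtain ⟨K, hK⟩ := hvs.lipschitzWith_of_hasCompactSupport hvc one_ne_zero
    obtain ⟨B, hB⟩ := hvc.exists_bound_of_continuous hvs.continuous
    obtain ⟨γ, h0, hγ⟩ := exists_forward_solution_of_lipschitzWith hK
      (L := B.toNNReal) (fun x => (hB x).trans (Real.le_coe_toNNReal B)) F₀
    have hveq : ∀ x ∈ closedBall F ε, v x = -g x := fun x hx => by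
      rw [hv]
      simp only [χ.one_of_mem_closedBall hx, one_smul]
    refine ⟨γ, fun t ht => ?_, h0⟩
    have := mem_ball_of_gradient_line hg hφ hc0 hveq (fun x hx => (hεsub hx).2) hγ
      (by rw [h0]; exact hF₀.1) ht
    rw [← hveq _ (ball_subset_closedBall this)]
    exact hγ t ht
  · have hmem : ∀ t, 0 ≤ t → γ t ∈ ball F ε := fun t ht =>
      mem_ball_of_gradient_line hg hφ hc0 (v := fun x => -g x) (fun x _ => rfl)
        (fun x hx => (hεsub hx).2) hγ (by rw [h0]; exact hF₀.1) ht
    obtain ⟨x, hx0, hx, hxt⟩ := exists_limit_of_gradient_line hg hφ hc0 hγ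
      (fun t ht => (hεsub (ball_subset_closedBall (hmem t ht))).2)
    refine ⟨fun t ht => (hεsub (ball_subset_closedBall (hmem t ht))).1, x,
      (hεsub (isClosed_closedBall.mem_of_tendsto hx ((eventually_ge_atTop (0 : ℝ)).mono
        fun t ht => ball_subset_closedBall (hmem t ht)))).1, hx0, fun t ht => ?_⟩
    have hdist : √(φ F₀) ≤ L * infDist F₀ {x | φ x = 0} := by
      rw [← div_le_iff₀' hL0]
      refine (le_infDist ⟨F, hF⟩).2 fun {z} hz => ?_
      rw [div_le_iff₀' hL0]
      have hF₀V : F₀ ∈ V := hrV (by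
        rw [mem_closedBall, dist_eq_norm]
        linarith [hF₀.2])
      -- The local estimate applies to zeros close to `F₀`. A distant zero `z` is farther from `F₀`
      -- than `F` is, and `F` is itself a zero.
      by_cases hzr : dist F₀ z ≤ r / 2
      · have hzV : z ∈ V := hrV (by
          rw [mem_closedBall]
          have h1 := dist_triangle_left z F F₀
          have h2 := hF₀.2
          rw [← dist_eq_norm] at h2
          linarith)
        rw [dist_eq_norm]
        exact hVL F₀ hF₀V z hzV hz
      · have h1 : √(φ F₀) ≤ L * ‖F₀ - F‖ := hVL F₀ hF₀V F (mem_of_mem_nhds hV) hF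
        refine h1.trans ?_
        gcongr
        linarith [hF₀.2]
    refine (hxt t ht).trans ?_
    rw [h0]
    calc 2 / √c * (Real.exp (-(c / 2 * t)) * √(φ F₀))
        ≤ 2 / √c * (Real.exp (-(c / 2 * t)) * (L * infDist F₀ {x | φ x = 0})) := by gcongr
      _ = _ := by ring

end GradientFlow

end

noncomputable section

/-! ### Uniform preimage bounds at constant rank -/

section ConstantRank

open Filter
open scoped NNReal

variable {X E N : Type*} [TopologicalSpace X] [NormedAddCommGroup E] [NormedSpace ℝ E]
  [FiniteDimensional ℝ E] [NormedAddCommGroup N] [NormedSpace ℝ N]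

/-- The nonzero singular values of a continuous family of linear maps of constant rank are locally
bounded below: elements of the range have preimages of comparable norm. -/
theorem exists_preimage_norm_le_of_constant_rank {A : X → E →L[ℝ] N} {x₀ : X}
    (hA : ContinuousAt A x₀) {r : ℕ}
    (hr : ∀ᶠ x in 𝓝 x₀, Module.finrank ℝ (LinearMap.range (A x).toLinearMap) = r) :
    ∃ k : ℝ, 0 < k ∧ ∀ᶠ x in 𝓝 x₀, ∀ y ∈ LinearMap.range (A x).toLinearMap,
      ∃ v, A x v = y ∧ ‖v‖ ≤ k * ‖y‖ := by
  obtain ⟨S, hS⟩ := Submodule.exists_isCompl (LinearMap.ker (A x₀).toLinearMap)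
  have hdim : Module.finrank ℝ S = r := by
    have h1 := Submodule.finrank_add_eq_of_isCompl hS
    have h2 := LinearMap.finrank_range_add_finrank_ker (A x₀).toLinearMap
    have h3 := hr.self_of_nhds
    omega
  have hker : LinearMap.ker ((A x₀).toLinearMap.domRestrict S) = ⊥ := by
    rw [LinearMap.ker_eq_bot']
    intro s hs
    exact Subtype.ext (Submodule.disjoint_def.1 hS.disjoint s hs s.2)
  obtain ⟨K, hK, hKA⟩ := LinearMap.exists_antilipschitzWith _ hker
  have hbase : ∀ s : S, ‖s‖ ≤ K * ‖A x₀ s‖ := fun s => by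
    simpa using hKA.le_mul_norm_sub s 0
  have hKpos : (0 : ℝ) < K := hK
  -- With this threshold the perturbation costs at most `‖s‖ / 2` in `hbase`, so the lower bound on
  -- the complement `S` of the kernel survives with `2 * K`.
  have hclose : ∀ᶠ x in 𝓝 x₀, ‖A x - A x₀‖ < 1 / (2 * K) := by
    have h := (hA.sub (continuousAt_const (y := A x₀))).norm
    refine h.eventually_lt_const ?_
    simpa using hKpos
  refine ⟨2 * K, by positivity, ?_⟩
  filter_upwards [hclose, hr] with x hx hrx y hy
  have hbound : ∀ s : S, ‖s‖ ≤ 2 * K * ‖A x s‖ := fun s => by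
    have h1 : ‖A x₀ s‖ ≤ ‖A x s‖ + ‖(A x - A x₀) s‖ := by
      have := norm_sub_le (A x s) ((A x - A x₀) s)
      simpa using this
    have h2 : ‖(A x - A x₀) s‖ ≤ 1 / (2 * K) * ‖s‖ :=
      ((A x - A x₀).le_opNorm s).trans (by gcongr; rfl)
    have h3 : K * (1 / (2 * K) * ‖s‖) = ‖s‖ / 2 := by field_simp
    have h4 := hbase s
    have h5 : (K : ℝ) * ‖A x₀ s‖ ≤ K * (‖A x s‖ + 1 / (2 * K) * ‖s‖) := by
      gcongr
      linarith
    rw [mul_add, h3] at h5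
    linarith
  have hinj : Function.Injective ((A x).toLinearMap.domRestrict S) := by
    rw [← LinearMap.ker_eq_bot, LinearMap.ker_eq_bot']
    intro s hs
    have h1 := hbound s
    have h2 : A x s = 0 := hs
    rw [h2, norm_zero, mul_zero] at h1
    exact norm_le_zero_iff.1 h1
  have hle : LinearMap.range ((A x).toLinearMap.domRestrict S)
      ≤ LinearMap.range (A x).toLinearMap := by
    rintro _ ⟨s, rfl⟩
    exact ⟨s, rfl⟩
  -- Constancy of the rank enters here: `A x` is injective on `S`, whose dimension is the rank, so
  -- the image of `S` is the whole range.
  have heq := Submodule.eq_of_le_of_finrank_eq hle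
    (by rw [LinearMap.finrank_range_of_inj hinj, hdim, hrx])
  rw [← heq] at hy
  obtain ⟨s, rfl⟩ := hy
  exact ⟨s, rfl, hbound s⟩

end ConstantRank

/-! ### The Polyak–Łojasiewicz inequality for quadratic maps -/

section PolyakLojasiewicz

open Filter

variable {E N : Type*} [NormedAddCommGroup E] [InnerProductSpace ℝ E]
  [NormedAddCommGroup N] [NormedSpace ℝ N]

/-- Euler's identity for quadratically homogeneous maps. -/
theorem HasFDerivAt.apply_self_of_quadratic {m : E → N} (hm : ∀ (t : ℝ) x, m (t • x) = t ^ 2 • m x)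
    {x : E} {D : E →L[ℝ] N} (hD : HasFDerivAt m D x) : D x = (2 : ℝ) • m x := by
  have h1 : HasDerivAt (fun t : ℝ => t • x) x 1 := by
    simpa using (hasDerivAt_id (1 : ℝ)).smul_const x
  have h2 : HasDerivAt (fun t : ℝ => m (t • x)) (D x) 1 :=
    HasFDerivAt.comp_hasDerivAt 1 (by rwa [one_smul]) h1
  have h3 : HasDerivAt (fun t : ℝ => m (t • x)) ((2 : ℝ) • m x) 1 := by
    simp only [hm]
    simpa using (hasDerivAt_pow 2 (1 : ℝ)).smul_const (m x)
  exact h2.unique h3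

/-- A quadratically homogeneous map of locally constant rank lies in the range of its derivative,
which yields a Polyak–Łojasiewicz inequality for its squared norm. -/
theorem polyak_lojasiewicz_of_constant_rank [FiniteDimensional ℝ E] {m : E → N}
    {D : E → E →L[ℝ] N} {φ : E → ℝ}
    {g : E → E} {F : E} {B : ℝ} {r : ℕ} (hm : ∀ (t : ℝ) x, m (t • x) = t ^ 2 • m x)
    (hD : ∀ x, HasFDerivAt m (D x) x) (hDc : ContinuousAt D F)
    (hr : ∀ᶠ x in 𝓝 F, Module.finrank ℝ (LinearMap.range (D x).toLinearMap) = r)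
    (hg : ∀ x v, D x v = m x → ⟪g x, v⟫_ℝ = 2 * φ x) (hφ : ∀ x, 0 ≤ φ x) (hB0 : 0 < B)
    (hB : ∀ x, ‖m x‖ ^ 2 ≤ B * φ x) :
    ∃ c : ℝ, 0 < c ∧ ∀ᶠ x in 𝓝 F, c * φ x ≤ ‖g x‖ ^ 2 := by
  obtain ⟨k, hk, hev⟩ := exists_preimage_norm_le_of_constant_rank hDc hr
  -- The constant comes from squaring `2 * φ ≤ ‖g‖ * k * ‖m‖`, inserting `‖m‖ ^ 2 ≤ B * φ` and
  -- cancelling one factor φ.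
  refine ⟨4 / (k ^ 2 * B), by positivity, hev.mono fun x hx => ?_⟩
  have hmem : m x ∈ LinearMap.range (D x).toLinearMap :=
    ⟨(1 / 2 : ℝ) • x, by
      change D x ((1 / 2 : ℝ) • x) = m x
      rw [map_smul, (hD x).apply_self_of_quadratic hm, smul_smul]
      norm_num⟩
  -- The Euler preimage `x / 2` does not become small with `m x`; it is replaced by one that does.
  obtain ⟨v, hv, hvn⟩ := hx _ hmem
  rcases (hφ x).eq_or_lt with h0 | hpos
  · rw [← h0, mul_zero]
    positivity
  have h1 : 2 * φ x ≤ ‖g x‖ * (k * ‖m x‖) := by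
    rw [← hg x v hv]
    exact (real_inner_le_norm _ _).trans (by gcongr)
  have h2 : (2 * φ x) ^ 2 ≤ ‖g x‖ ^ 2 * (k ^ 2 * (B * φ x)) := by
    refine (pow_le_pow_left₀ (by positivity) h1 2).trans ?_
    rw [mul_pow, mul_pow]
    gcongr
    exact hB x
  rw [div_mul_eq_mul_div, div_le_iff₀ (by positivity)]
  nlinarith

end PolyakLojasiewicz

/-! ### The moment map and the energy on the torus -/

namespace PolyTorus

namespace Triangulation

open Filter

variable {Γ : Submodule ℤ HH} (T : Triangulation Γ)

/-- Evaluation of a form on a four-cell at a vector. -/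
def evalCLM (σ : T.FourCell) (v : HH) : T.Forms →L[ℝ] HH :=
  LinearMap.toContinuousLinearMap
    { toFun := fun F => F σ v
      map_add' := fun _ _ => rfl
      map_smul' := fun _ _ => rfl }

theorem moment_apply (F : T.Forms) (a : Fin 3) (σ : T.FourCell) :
    T.moment F a σ = -(1 / 2) * ∑ e : Fin 4,
      ⟪-(T.evalCLM σ (unit a * stdBasis e) F) * unit 0, T.evalCLM σ (stdBasis e) F⟫_ℝ :=
  rfl

theorem contDiff_moment {n : WithTop ℕ∞} : ContDiff ℝ n T.moment := by
  refine contDiff_pi.2 fun a => contDiff_pi.2 fun σ => ?_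
  simp only [moment_apply]
  refine contDiff_const.mul (ContDiff.sum fun e _ => ContDiff.inner ℝ ?_ ?_)
  · exact (T.evalCLM σ _).contDiff.neg.mul contDiff_const
  · exact (T.evalCLM σ _).contDiff

theorem moment_smul (t : ℝ) (F : T.Forms) : T.moment (t • F) = t ^ 2 • T.moment F := by
  funext a σ
  simp only [Pi.smul_apply, smul_eq_mul, moment_apply, map_smul, Finset.mul_sum]
  refine Finset.sum_congr rfl fun e _ => ?_
  rw [← smul_neg, smul_mul_assoc, real_inner_smul_left, real_inner_smul_right]
  ring

theorem contDiff_energy {n : WithTop ℕ∞} : ContDiff ℝ n T.energy := by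
  refine contDiff_const.mul (ContDiff.sum fun a _ => ContDiff.sum fun σ _ => ?_)
  exact ((contDiff_pi.1 (contDiff_pi.1 T.contDiff_moment a) σ).pow 2).mul contDiff_const

theorem energy_nonneg (F : T.Forms) : 0 ≤ T.energy F := by
  refine mul_nonneg (by norm_num) (Finset.sum_nonneg fun a _ => Finset.sum_nonneg fun σ _ => ?_)
  exact mul_nonneg (sq_nonneg _) (T.vol_pos σ).le

theorem moment_sq_mul_vol_le (F : T.Forms) (a : Fin 3) (σ : T.FourCell) :
    T.moment F a σ ^ 2 * T.vol σ ≤ 2 * T.energy F := by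
  have hn : ∀ b τ, 0 ≤ T.moment F b τ ^ 2 * T.vol τ := fun b τ =>
    mul_nonneg (sq_nonneg _) (T.vol_pos τ).le
  have h1 : T.moment F a σ ^ 2 * T.vol σ ≤ ∑ τ, T.moment F a τ ^ 2 * T.vol τ :=
    Finset.single_le_sum (f := fun τ => T.moment F a τ ^ 2 * T.vol τ) (fun τ _ => hn a τ)
      (Finset.mem_univ σ)
  have h2 : ∑ τ, T.moment F a τ ^ 2 * T.vol τ ≤ ∑ b, ∑ τ, T.moment F b τ ^ 2 * T.vol τ :=
    Finset.single_le_sum (f := fun b => ∑ τ, T.moment F b τ ^ 2 * T.vol τ)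
      (fun b _ => Finset.sum_nonneg fun τ _ => hn b τ) (Finset.mem_univ a)
  rw [energy]
  linarith

/-- The sup norm of μ and its volume-weighted L² norm are equivalent, since the finitely many cells
have positive volume; this and the next lemma are the two halves. -/
theorem exists_norm_moment_sq_le_energy :
    ∃ B : ℝ, 0 < B ∧ ∀ F : T.Forms, ‖T.moment F‖ ^ 2 ≤ B * T.energy F := by
  have hs : 0 ≤ ∑ σ, 2 / T.vol σ := Finset.sum_nonneg fun σ _ => by
    have := T.vol_pos σ
    positivity
  refine ⟨∑ σ, 2 / T.vol σ + 1, by linarith, fun F => ?_⟩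
  have hE := T.energy_nonneg F
  have hBE : 0 ≤ (∑ σ, 2 / T.vol σ + 1) * T.energy F := by positivity
  rw [← Real.le_sqrt (norm_nonneg _) hBE, pi_norm_le_iff_of_nonneg (Real.sqrt_nonneg _)]
  refine fun a => (pi_norm_le_iff_of_nonneg (Real.sqrt_nonneg _)).2 fun σ => ?_
  rw [Real.norm_eq_abs]
  refine Real.abs_le_sqrt ?_
  have hv := T.vol_pos σ
  have h1 : T.moment F a σ ^ 2 ≤ 2 / T.vol σ * T.energy F := by
    rw [div_mul_eq_mul_div, le_div_iff₀ hv]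
    exact T.moment_sq_mul_vol_le F a σ
  have h2 : 2 / T.vol σ ≤ ∑ τ, 2 / T.vol τ :=
    Finset.single_le_sum (f := fun τ => 2 / T.vol τ)
      (fun τ _ => by have := T.vol_pos τ; positivity) (Finset.mem_univ σ)
  exact h1.trans (by gcongr; linarith)

theorem exists_energy_le_norm_moment_sq :
    ∃ M : ℝ, 0 ≤ M ∧ ∀ F : T.Forms, T.energy F ≤ M * ‖T.moment F‖ ^ 2 := by
  refine ⟨1 / 2 * ∑ _a : Fin 3, ∑ σ, T.vol σ, mul_nonneg (by norm_num)
    (Finset.sum_nonneg fun a _ => Finset.sum_nonneg fun σ _ => (T.vol_pos σ).le), fun F => ?_⟩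
  rw [energy, mul_assoc, Finset.sum_mul]
  refine mul_le_mul_of_nonneg_left (Finset.sum_le_sum fun a _ => ?_) (by norm_num)
  rw [Finset.sum_mul]
  refine Finset.sum_le_sum fun σ _ => ?_
  rw [mul_comm]
  refine mul_le_mul_of_nonneg_left ?_ (T.vol_pos σ).le
  rw [← sq_abs, ← Real.norm_eq_abs]
  gcongr
  exact (norm_le_pi_norm (T.moment F a) σ).trans (norm_le_pi_norm (T.moment F) a)

theorem energy_eq_zero_iff (F : T.Forms) : T.energy F = 0 ↔ T.moment F = 0 := by
  constructor
  · intro h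
    obtain ⟨B, _, hB⟩ := T.exists_norm_moment_sq_le_energy
    have h1 := hB F
    rw [h, mul_zero] at h1
    exact norm_eq_zero.1 (pow_eq_zero_iff two_ne_zero |>.1 (le_antisymm h1 (sq_nonneg _)))
  · intro h
    simp [energy, h]

variable (α : T.H1)

theorem contDiff_momentOn {n : WithTop ℕ∞} : ContDiff ℝ n (T.momentOn α) :=
  T.contDiff_moment.comp (T.closedForms α).subtypeL.contDiff

theorem zeroLocus_eq : T.zeroLocus α = {F : T.closedForms α | T.energy (F : T.Forms) = 0} := by
  ext F
  exact (T.energy_eq_zero_iff F).symm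

/-- The flow field is the negative gradient of the restriction of the energy. -/
theorem hasGradientAt_energy_coe (F : T.closedForms α) :
    HasGradientAt (fun G : T.closedForms α => T.energy (G : T.Forms)) (-T.flowField α F) F := by
  have h1 : HasGradientAt T.energy (gradient T.energy (F : T.Forms)) F :=
    ((T.contDiff_energy (n := 1)).differentiable one_ne_zero).differentiableAt.hasGradientAt
  rw [hasGradientAt_iff_hasFDerivAt]
  have h2 : HasFDerivAt (fun G : T.closedForms α => T.energy (G : T.Forms)) _ F :=
    h1.hasFDerivAt.comp F (T.closedForms α).subtypeL.hasFDerivAt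
  refine h2.congr_fderiv ?_
  ext v
  change ⟪gradient T.energy (F : T.Forms), (v : T.Forms)⟫_ℝ = ⟪-T.flowField α F, v⟫_ℝ
  rw [flowField, neg_neg, Submodule.inner_orthogonalProjectionOnto_eq_of_mem_right]

theorem contDiff_flowField : ContDiff ℝ 1 (T.flowField α) := by
  have h1 : ContDiff ℝ 1 (gradient T.energy) :=
    (InnerProductSpace.toDual ℝ T.Forms).symm.toContinuousLinearEquiv.contDiff.comp
      ((T.contDiff_energy (n := 2)).fderiv_right (by norm_num))
  exact ((T.closedForms α).orthogonalProjectionOnto.contDiff.comp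
    (h1.comp (T.closedForms α).subtypeL.contDiff)).neg

/-- Differentiating `½ ‖μ‖²` at `F` in the direction `v` gives the L² pairing of μ with `dμ(v) = μ`,
which is `‖μ‖² = 2φ`. -/
theorem inner_gradient_eq_of_fderiv_momentOn_eq (F v : T.closedForms α)
    (hv : fderiv ℝ (T.momentOn α) F v = T.momentOn α F) :
    ⟪-T.flowField α F, v⟫_ℝ = 2 * T.energy (F : T.Forms) := by
  have hline : HasDerivAt (fun t : ℝ => F + t • v) v 0 := by
    simpa using ((hasDerivAt_id (0 : ℝ)).smul_const v).const_add F
  have hm : HasFDerivAt (T.momentOn α) (fderiv ℝ (T.momentOn α) F) (F + (0 : ℝ) • v) := by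
    rw [zero_smul, add_zero]
    exact ((T.contDiff_momentOn α (n := 1)).differentiable one_ne_zero).differentiableAt.hasFDerivAt
  have h1 : HasDerivAt (fun t : ℝ => T.momentOn α (F + t • v)) (T.momentOn α F) 0 := by
    rw [← hv]
    exact hm.comp_hasDerivAt 0 hline
  have h2 : ∀ a σ, HasDerivAt (fun t : ℝ => T.momentOn α (F + t • v) a σ)
      (T.momentOn α F a σ) 0 := fun a σ => hasDerivAt_pi.1 (hasDerivAt_pi.1 h1 a) σ
  have h3 : HasDerivAt (fun t : ℝ => T.energy ((F + t • v : T.closedForms α) : T.Forms))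
      (1 / 2 * ∑ a : Fin 3, ∑ σ : T.FourCell,
        ((2 : ℕ) : ℝ) * T.momentOn α (F + (0 : ℝ) • v) a σ ^ (2 - 1) * T.momentOn α F a σ
          * T.vol σ) 0 := by
    refine HasDerivAt.const_mul _ (HasDerivAt.fun_sum fun a _ => HasDerivAt.fun_sum fun σ _ => ?_)
    exact ((h2 a σ).pow 2).mul_const _
  have h4 : HasDerivAt (fun t : ℝ => T.energy ((F + t • v : T.closedForms α) : T.Forms))
      ⟪-T.flowField α F, v⟫_ℝ 0 := by
    have hg : HasGradientAt (fun G : T.closedForms α => T.energy (G : T.Forms))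
        (-T.flowField α F) (F + (0 : ℝ) • v) := by
      rw [zero_smul, add_zero]
      exact T.hasGradientAt_energy_coe α F
    exact hg.hasFDerivAt.comp_hasDerivAt 0 hline
  rw [h4.unique h3, energy]
  simp only [Finset.mul_sum]
  refine Finset.sum_congr rfl fun a _ => Finset.sum_congr rfl fun σ _ => ?_
  rw [zero_smul, add_zero, momentOn]
  push_cast
  ring

/-- `√φ` is bounded by a multiple of the norm of μ, and μ is Lipschitz near `F` and vanishes at
`p.2`. This turns the initial energy into a distance to the zero locus. -/
theorem eventually_sqrt_energy_le (F : T.closedForms α) :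
    ∃ L : ℝ, 0 < L ∧ ∀ᶠ p : T.closedForms α × T.closedForms α in 𝓝 F ×ˢ 𝓝 F,
      T.energy (p.2 : T.Forms) = 0 → √(T.energy (p.1 : T.Forms)) ≤ L * ‖p.1 - p.2‖ := by
  obtain ⟨M, hM0, hM⟩ := T.exists_energy_le_norm_moment_sq
  obtain ⟨K, s, hs, hK⟩ := (T.contDiff_momentOn α (n := 1)).contDiffAt (x := F)
    |>.exists_lipschitzOnWith
  refine ⟨√M * K + 1, by positivity, ?_⟩
  filter_upwards [prod_mem_prod hs hs] with p hp hp0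
  have h0 : T.momentOn α p.2 = 0 := (T.energy_eq_zero_iff _).1 hp0
  have h1 := hK.norm_sub_le hp.1 hp.2
  rw [h0, sub_zero] at h1
  calc √(T.energy (p.1 : T.Forms)) ≤ √(M * ‖T.momentOn α p.1‖ ^ 2) := Real.sqrt_le_sqrt (hM _)
    _ = √M * ‖T.momentOn α p.1‖ := by rw [Real.sqrt_mul hM0, Real.sqrt_sq (norm_nonneg _)]
    _ ≤ √M * (K * ‖p.1 - p.2‖) := by gcongr
    _ ≤ (√M * K + 1) * ‖p.1 - p.2‖ := by linarith [norm_nonneg (p.1 - p.2)]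

theorem eventually_energy_le_norm_flowField_sq {F : T.closedForms α} (hF : T.IsRegular α F) :
    ∃ c : ℝ, 0 < c ∧ ∀ᶠ G : T.closedForms α in 𝓝 F,
      c * T.energy (G : T.Forms) ≤ ‖-T.flowField α G‖ ^ 2 := by
  obtain ⟨r, hr⟩ := hF
  obtain ⟨B, hB0, hB⟩ := T.exists_norm_moment_sq_le_energy
  have hm := T.contDiff_momentOn α (n := 1)
  have hs : ∀ (t : ℝ) (G : T.closedForms α), T.momentOn α (t • G) = t ^ 2 • T.momentOn α G :=
    fun t G => T.moment_smul t G
  have hD : ∀ G, HasFDerivAt (T.momentOn α) (fderiv ℝ (T.momentOn α) G) G :=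
    fun G => (hm.differentiable one_ne_zero).differentiableAt.hasFDerivAt
  have hDc : ContinuousAt (fderiv ℝ (T.momentOn α)) F :=
    (hm.continuous_fderiv one_ne_zero).continuousAt
  have hB' : ∀ G, ‖T.momentOn α G‖ ^ 2 ≤ B * T.energy (G : T.Forms) := fun G => hB G
  exact polyak_lojasiewicz_of_constant_rank hs hD hDc hr
    (T.inner_gradient_eq_of_fderiv_momentOn_eq α) (fun G => T.energy_nonneg _) hB0 hB'

end Triangulation

end PolyTorus

end

theorem mainTheorem10 (Γ : Submodule ℤ PolyTorus.HH) [DiscreteTopology Γ] [IsZLattice ℝ Γ]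
    (T : PolyTorus.Triangulation Γ) (α : T.H1) (F : T.closedForms α)
    (hzero : F ∈ T.zeroLocus α) (hreg : T.IsRegular α F) :
    ∃ C : ℝ, 0 < C ∧ ∃ lam : ℝ, 0 < lam ∧ ∀ U ∈ 𝓝 F, ∃ W ∈ 𝓝 F, ∀ F₀ ∈ W,
      (∃ γ : ℝ → T.closedForms α, T.IsFlowLine α γ ∧ γ 0 = F₀) ∧
      ∀ γ : ℝ → T.closedForms α, T.IsFlowLine α γ → γ 0 = F₀ →
        (∀ t : ℝ, 0 ≤ t → γ t ∈ U) ∧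
        ∃ Finf ∈ U, Finf ∈ T.zeroLocus α ∧
          ∀ t : ℝ, 0 ≤ t → ‖γ t - Finf‖ ≤
            C * Real.exp (-(lam * t)) * Metric.infDist F₀ (T.zeroLocus α) := by
  obtain ⟨c, hc0, hc⟩ := T.eventually_energy_le_norm_flowField_sq α hreg
  obtain ⟨L, hL0, hL⟩ := T.eventually_sqrt_energy_le α F
  rw [T.zeroLocus_eq α] at hzero ⊢
  -- The gradient is minus the flow field, so the resulting equation carries a double negation.
  have hflow := gradient_flow_exponentially_stable (T.hasGradientAt_energy_coe α)
    (T.contDiff_flowField α).neg (fun G => T.energy_nonneg _) hc0 hzero hc hL0 hL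
  simp only [neg_neg] at hflow
  exact hflow
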